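/- For real $q$ let $\exp_q$ denote the Tsallis $q$-exponential, $\exp_q(t)=(1+(1-q)t)^{1/(1-q)}$ for $q\neq 1$ and $\exp_1(t)=e^t$ (for $t$ near $0$). For real $x,p,q$ the $p,q$-deformed Touchard polynomials $T_n(x;p,q)$ are defined by the exponential generating function $$\exp_p\bigl(x(\exp_q(t)-1)\bigr)=\sum_{n=0}^\infty T_n(x;p,q)\frac{t^n}{n!},$$ that is, $T_n(x;p,q)$ is the $n$-th derivative at $t=0$ of the left-hand side, and this expansion holds for all $t$ in a neighbourhood of $0$ (depending on $x,p,q$). Then for every integer $n\ge 1$, $T_n(x;p,q)$ is the polynomial in $x$, $p$ and $q$ given by $$T_n(x;p,q)=\sum_{k=0}^n\sum_{m=0}^{k-1}\sum_{\ell=0}^{n-k}\sum_{i=m}^{k-1}\sum_{j=\ell}^{n-k}\binom{i}{m}\binom{j}{\ell}(-1)^{m+\ell}\,s(n,n-j)\,S(n-j,k)\,s(k,k-i)\,p^m q^\ell x^k,$$ where $s(a,b)$ are the signed Stirling numbers of the first kind ($(-1)^{a-b}$ times the number of permutations of $a$ elements with $b$ cycles), $S(a,b)$ are the Stirling numbers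 of the second kind, and empty sums are $0$. -/

import Mathlib

open Filter Topology

noncomputable section

/-- The Tsallis (NEXT) `q`-exponential: `(1 + (1 - q) t) ^ (1 / (1 - q))` for `q ≠ 1`, and the
limiting value `e ^ t` for `q = 1`. (Only its values for `t` near `0`, where the base is
positive, are relevant below.) -/
def nextExp (q t : ℝ) : ℝ :=
  if q = 1 then Real.exp t else (1 + (1 - q) * t) ^ (1 / (1 - q))

/-- The function of `t` whose expansion in `t ^ n / n!` generates the `p,q`-deformed Touchard
polynomials evaluated at `x`. -/
def touchardGen (x p q t : ℝ) : ℝ :=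
  nextExp p (x * (nextExp q t - 1))

/-- The value at `x` of the `n`-th `p,q`-deformed Touchard polynomial: the coefficient of
`t ^ n / n!` in the Taylor expansion at `t = 0` of `exp_p (x (exp_q t - 1))`. -/
def deformedTouchard (n : ℕ) (x p q : ℝ) : ℝ :=
  iteratedDeriv n (touchardGen x p q) 0

/-- The signed Stirling number of the first kind, `(-1) ^ (n - k)` times the unsigned one
(written with `n + k`, which has the same parity, to avoid truncated subtraction). -/
def signedStirlingFirst (n k : ℕ) : ℤ :=
  (-1) ^ (n + k) * (Nat.stirlingFirst n k : ℤ)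

end

/-! With `b = 1 - q`, the function `g = exp_q` satisfies `(1 + b t) g' = g`. Hence each derivative
of `f (x (g - 1))` is `(1 + b t)^(-n)` times a combination of the terms `x^k g^k f^(k)`, and
differentiating once more gives the coefficients the recurrence `a(n+1, k) = (k - n b) a(n, k) +
a(n, k-1)`. Its solution is `∑ s(n, m) b^(n-m) S(m, k)`, by the recurrences of both kinds of
Stirling numbers. At `t = 0` the `k`-th derivative of `exp_p` is `∏_{j<k} (1 - j (1 - p))`, which
expands through `s(k, k - i) (1 - p)^i`. Binomial expansion in `p` and `q` gives the five-fold sum.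
The series converges near `0` by analyticity. -/

open Finset in
/-- The sum of `s(n, m) * b ^ (n - m) * h m` over `m`: the falling factorial with step `b`,
evaluated under the functional sending the `m`-th power to `h m`. -/
def stirlingFunctional (b : ℝ) (h : ℕ → ℝ) (n : ℕ) : ℝ :=
  ∑ m ∈ range (n + 1), (signedStirlingFirst n m : ℝ) * b ^ (n - m) * h m

lemma signedStirlingFirst_succ_zero (n : ℕ) : signedStirlingFirst (n + 1) 0 = 0 := by
  simp [signedStirlingFirst]

lemma signedStirlingFirst_eq_zero_of_lt {n k : ℕ} (h : n < k) : signedStirlingFirst n k = 0 := by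
  simp [signedStirlingFirst, Nat.stirlingFirst_eq_zero_of_lt h]

lemma signedStirlingFirst_succ_succ (n k : ℕ) :
    signedStirlingFirst (n + 1) (k + 1) =
      signedStirlingFirst n k - n * signedStirlingFirst n (k + 1) := by
  simp only [signedStirlingFirst, Nat.stirlingFirst_succ_succ]
  push_cast
  ring

lemma mul_signedStirlingFirst_zero (n : ℕ) : (n : ℝ) * (signedStirlingFirst n 0 : ℝ) = 0 := by
  cases n <;> simp [signedStirlingFirst_succ_zero]

lemma stirlingFunctional_zero (b : ℝ) (h : ℕ → ℝ) : stirlingFunctional b h 0 = h 0 := by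
  simp [stirlingFunctional, signedStirlingFirst]

-- This is `X (X - b) ⋯ (X - n b)` with its last factor split off: multiplying by `X` shifts `h`.
open Finset in
lemma stirlingFunctional_succ (b : ℝ) (h : ℕ → ℝ) (n : ℕ) :
    stirlingFunctional b h (n + 1) =
      stirlingFunctional b (fun m => h (m + 1)) n - n * b * stirlingFunctional b h n := by
  -- Reindexing by `m + 1` loses nothing: `n * s(n, 0) = 0`, and the added top term has `s(n, n + 1)
  -- = 0`.
  have hext : n * b * stirlingFunctional b h n =
      ∑ m ∈ range (n + 1),
        n * (signedStirlingFirst n (m + 1) : ℝ) * b ^ (n - m) * h (m + 1) := by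
    rw [stirlingFunctional, sum_range_succ', sum_range_succ
      (fun m => n * (signedStirlingFirst n (m + 1) : ℝ) * b ^ (n - m) * h (m + 1)),
      signedStirlingFirst_eq_zero_of_lt n.lt_succ_self, mul_add, mul_sum]
    have h0 : n * b * ((signedStirlingFirst n 0 : ℝ) * b ^ (n - 0) * h 0) = 0 := by
      linear_combination b * b ^ (n - 0) * h 0 * mul_signedStirlingFirst_zero n
    rw [h0]
    simp only [Int.cast_zero, mul_zero, zero_mul, add_zero]
    refine sum_congr rfl fun m hm => ?_
    have : n - m = (n - (m + 1)) + 1 := by have := mem_range.1 hm; omega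
    rw [this, pow_succ]
    ring
  rw [hext, stirlingFunctional, sum_range_succ', signedStirlingFirst_succ_zero, stirlingFunctional,
    ← sum_sub_distrib]
  simp only [Int.cast_zero, zero_mul, add_zero]
  refine sum_congr rfl fun m _ => ?_
  rw [signedStirlingFirst_succ_succ, Nat.add_sub_add_right]
  push_cast
  ring

lemma stirlingFunctional_one (b : ℝ) (n : ℕ) :
    stirlingFunctional b (fun _ => 1) n = ∏ j ∈ Finset.range n, (1 - j * b) := by
  induction n with
  | zero => simp [stirlingFunctional_zero]
  | succ n ih => rw [stirlingFunctional_succ, ih, Finset.prod_range_succ]; ring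

/-- The coefficient of `t ^ n / n!` in `(exp_q t - 1) ^ k / k!`, where `b = 1 - q`. -/
def deformedStirling (b : ℝ) (n k : ℕ) : ℝ :=
  stirlingFunctional b (fun m => (Nat.stirlingSecond m k : ℝ)) n

lemma deformedStirling_succ_zero (b : ℝ) (n : ℕ) :
    deformedStirling b (n + 1) 0 = - (n * b) * deformedStirling b n 0 := by
  rw [deformedStirling, stirlingFunctional_succ]
  simp [stirlingFunctional, deformedStirling]

lemma deformedStirling_succ_succ (b : ℝ) (n k : ℕ) :
    deformedStirling b (n + 1) (k + 1) =
      (((k + 1 : ℕ) : ℝ) - n * b) * deformedStirling b n (k + 1) + deformedStirling b n k := by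
  have : stirlingFunctional b (fun m => (Nat.stirlingSecond (m + 1) (k + 1) : ℝ)) n =
      ((k + 1 : ℕ) : ℝ) * deformedStirling b n (k + 1) + deformedStirling b n k := by
    simp only [deformedStirling, stirlingFunctional, Finset.mul_sum, ← Finset.sum_add_distrib,
      Nat.stirlingSecond_succ_succ]
    refine Finset.sum_congr rfl fun m _ => ?_
    push_cast
    ring
  rw [deformedStirling, stirlingFunctional_succ, this, deformedStirling]
  simp only [deformedStirling]
  ring

lemma deformedStirling_eq_zero_of_lt (b : ℝ) {n k : ℕ} (h : n < k) :
    deformedStirling b n k = 0 := by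
  rw [deformedStirling, stirlingFunctional]
  refine Finset.sum_eq_zero fun m hm => ?_
  have := Finset.mem_range.1 hm
  simp [Nat.stirlingSecond_eq_zero_of_lt (show m < k by omega)]

lemma deformedStirling_zero_zero (b : ℝ) : deformedStirling b 0 0 = 1 := by
  simp [deformedStirling, stirlingFunctional_zero]

lemma deformedStirling_zero_right (b : ℝ) {n : ℕ} (hn : n ≠ 0) : deformedStirling b n 0 = 0 := by
  induction n with
  | zero => exact absurd rfl hn
  | succ n ih =>
    rw [deformedStirling_succ_zero]
    rcases eq_or_ne n 0 with rfl | h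
    · simp
    · simp [ih h]

-- The recurrence in transposed form, matching how differentiation acts on the `k`-th term `y k`.
open Finset in
lemma deformedStirling_succ_sum (b : ℝ) (n : ℕ) (y : ℕ → ℝ) :
    ∑ k ∈ range (n + 2), deformedStirling b (n + 1) k * y k =
      ∑ k ∈ range (n + 1), deformedStirling b n k * ((k - n * b) * y k + y (k + 1)) := by
  have h1 : ∑ k ∈ range (n + 1), deformedStirling b n k * ((k - n * b) * y k) =
      ∑ k ∈ range (n + 2), deformedStirling b n k * ((k - n * b) * y k) := by
    rw [sum_range_succ (fun k => deformedStirling b n k * ((k - n * b) * y k)) (n + 1),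
      deformedStirling_eq_zero_of_lt b n.lt_succ_self]
    simp
  simp only [mul_add]
  rw [sum_add_distrib, h1,
    sum_range_succ' (fun k => deformedStirling b (n + 1) k * y k) (n + 1),
    sum_range_succ' (fun k => deformedStirling b n k * ((k - n * b) * y k)) (n + 1),
    deformedStirling_succ_zero]
  simp only [deformedStirling_succ_succ, add_mul, sum_add_distrib, Nat.cast_zero]
  have h2 : ∀ k, (((k + 1 : ℕ) : ℝ) - n * b) * deformedStirling b n (k + 1) * y (k + 1) =
    deformedStirling b n (k + 1) * ((((k + 1 : ℕ) : ℝ) - n * b) * y (k + 1)) := fun k => by ring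
  simp only [h2]
  ring

/-- If `(1 + b t) g' = g` near `0`, this is the `n`-th derivative of `f 0 (x (g t - 1))`, where
`f k` is the `k`-th derivative of `f 0`. -/
lemma iteratedDeriv_comp_of_log_deriv {b x : ℝ} {f : ℕ → ℝ → ℝ} {g : ℝ → ℝ}
    (hf : ∀ k, ∀ᶠ u in 𝓝 (0 : ℝ), HasDerivAt (f k) (f (k + 1) u) u)
    (hg : ∀ᶠ t in 𝓝 (0 : ℝ), HasDerivAt g (g t / (1 + b * t)) t) (hg0 : g 0 = 1) (n : ℕ) :
    iteratedDeriv n (fun t => f 0 (x * (g t - 1))) =ᶠ[𝓝 0] fun t =>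
      (∑ k ∈ Finset.range (n + 1), deformedStirling b n k *
        (x ^ k * g t ^ k * f k (x * (g t - 1)))) / (1 + b * t) ^ n := by
  induction n with
  | zero => simp [deformedStirling_zero_zero]
  | succ n ih =>
    rw [iteratedDeriv_succ]
    refine ih.deriv.trans ?_
    have hcont : Tendsto (fun t => x * (g t - 1)) (𝓝 0) (𝓝 0) := by
      have : ContinuousAt (fun t => x * (g t - 1)) 0 :=
        ((hg.self_of_nhds).continuousAt.sub continuousAt_const).const_mul x
      simpa [ContinuousAt, hg0] using this
    have hpos : ∀ᶠ t in 𝓝 (0 : ℝ), 1 + b * t ≠ 0 := by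
      have : ContinuousAt (fun t : ℝ => 1 + b * t) 0 := by fun_prop
      exact this.eventually_ne (by simp)
    have hfk : ∀ᶠ t in 𝓝 (0 : ℝ), ∀ k ∈ Finset.range (n + 1),
        HasDerivAt (f k) (f (k + 1) (x * (g t - 1))) (x * (g t - 1)) :=
      (Finset.eventually_all _).2 fun k _ => hcont.eventually (hf k)
    filter_upwards [hg, hpos, hfk] with t hgt ht hft
    have hu : HasDerivAt (fun t => x * (g t - 1)) (x * (g t / (1 + b * t))) t :=
      (hgt.sub_const 1).const_mul x
    have hterm : ∀ k ∈ Finset.range (n + 1), HasDerivAt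
        (fun t => deformedStirling b n k * (x ^ k * g t ^ k * f k (x * (g t - 1))))
        (deformedStirling b n k * (k * (x ^ k * g t ^ k * f k (x * (g t - 1))) +
          x ^ (k + 1) * g t ^ (k + 1) * f (k + 1) (x * (g t - 1))) / (1 + b * t)) t := by
      intro k hk
      have := (((hgt.pow k).const_mul (x ^ k)).mul ((hft k hk).comp t hu)).const_mul
        (deformedStirling b n k)
      refine this.congr_deriv ?_
      simp only [Function.comp, Pi.pow_apply]
      -- The power rule produces the truncated exponent `k - 1`, so `k = 0` is separate.
      rcases k with _ | k
      · simp
        ring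
      · simp only [Nat.add_sub_cancel]
        field_simp
        ring
    have hlin : HasDerivAt (fun t : ℝ => (1 + b * t) ^ n) (n * (1 + b * t) ^ (n - 1) * b) t := by
      simpa using (((hasDerivAt_id t).const_mul b).const_add 1).fun_pow n
    have hd := (HasDerivAt.fun_sum hterm).div hlin (pow_ne_zero n ht)
    refine hd.deriv.trans ?_
    rw [deformedStirling_succ_sum b n fun k => x ^ k * g t ^ k * f k (x * (g t - 1))]
    generalize x * (g t - 1) = u
    have hs : ∑ k ∈ Finset.range (n + 1), deformedStirling b n k *
          ((k - n * b) * (x ^ k * g t ^ k * f k u) + x ^ (k + 1) * g t ^ (k + 1) * f (k + 1) u) =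
        ∑ k ∈ Finset.range (n + 1), deformedStirling b n k *
          (k * (x ^ k * g t ^ k * f k u) + x ^ (k + 1) * g t ^ (k + 1) * f (k + 1) u) -
        n * b * ∑ k ∈ Finset.range (n + 1), deformedStirling b n k *
          (x ^ k * g t ^ k * f k u) := by
      rw [Finset.mul_sum, ← Finset.sum_sub_distrib]
      exact Finset.sum_congr rfl fun k _ => by ring
    rw [hs, ← Finset.sum_div]
    rcases n with _ | n
    · simp
    · simp only [Nat.add_sub_cancel]
      field_simp
      ring

lemma eventually_one_add_mul_pos (c : ℝ) : ∀ᶠ t in 𝓝 (0 : ℝ), 0 < 1 + c * t := by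
  have : ContinuousAt (fun t : ℝ => 1 + c * t) 0 := by fun_prop
  exact this.eventually_const_lt (by simp)

lemma nextExp_zero (q : ℝ) : nextExp q 0 = 1 := by
  unfold nextExp; split_ifs <;> simp

/-- The `k`-th derivative of the `p`-exponential where `0 < 1 + (1 - p) u`. -/
noncomputable def nextExpDeriv (p : ℝ) (k : ℕ) (u : ℝ) : ℝ :=
  (∏ j ∈ Finset.range k, (1 - j * (1 - p))) * (nextExp p u / (1 + (1 - p) * u) ^ k)

lemma nextExpDeriv_zero_left (p : ℝ) : nextExpDeriv p 0 = nextExp p := by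
  funext u; simp [nextExpDeriv]

/-- Lowering the exponent by one divides by the base; in this form `q = 1` needs no separate
statement. -/
lemma hasDerivAt_nextExp {q t : ℝ} (ht : 0 < 1 + (1 - q) * t) :
    HasDerivAt (nextExp q) (nextExp q t / (1 + (1 - q) * t)) t := by
  rcases eq_or_ne q 1 with rfl | hq
  · have : nextExp 1 = Real.exp := by funext u; simp [nextExp]
    simpa [this] using Real.hasDerivAt_exp t
  · have h1 : 1 - q ≠ 0 := sub_ne_zero.2 hq.symm
    have hE : nextExp q = fun u => (1 + (1 - q) * u) ^ (1 / (1 - q)) := by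
      funext u; simp [nextExp, hq]
    have hlin : HasDerivAt (fun u : ℝ => 1 + (1 - q) * u) (1 - q) t := by
      simpa using ((hasDerivAt_id t).const_mul (1 - q)).const_add 1
    have := hlin.rpow_const (p := 1 / (1 - q)) (Or.inl ht.ne')
    rw [hE]
    refine this.congr_deriv ?_
    rw [Real.rpow_sub_one ht.ne']
    field_simp

lemma hasDerivAt_nextExpDeriv {p u : ℝ} (k : ℕ) (hu : 0 < 1 + (1 - p) * u) :
    HasDerivAt (nextExpDeriv p k) (nextExpDeriv p (k + 1) u) u := by
  have hlin : HasDerivAt (fun t : ℝ => (1 + (1 - p) * t) ^ k)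
      (k * (1 + (1 - p) * u) ^ (k - 1) * (1 - p)) u := by
    simpa using (((hasDerivAt_id u).const_mul (1 - p)).const_add 1).fun_pow k
  have := ((hasDerivAt_nextExp hu).div hlin (pow_ne_zero k hu.ne')).const_mul
    (∏ j ∈ Finset.range k, (1 - j * (1 - p)))
  refine this.congr_deriv ?_
  rw [nextExpDeriv, Finset.prod_range_succ]
  have := hu.ne'
  rcases k with _ | k
  · simp
  · simp only [Nat.add_sub_cancel]
    generalize (∏ j ∈ Finset.range (k + 1), (1 - (j : ℝ) * (1 - p))) = P
    generalize 1 + (1 - p) * u = y at *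
    field_simp
    ring

lemma deformedTouchard_eq_sum (n : ℕ) (x p q : ℝ) :
    deformedTouchard n x p q = ∑ k ∈ Finset.range (n + 1),
      deformedStirling (1 - q) n k * (∏ j ∈ Finset.range k, (1 - j * (1 - p))) * x ^ k := by
  have h := (iteratedDeriv_comp_of_log_deriv (x := x) (f := nextExpDeriv p)
    (fun k => (eventually_one_add_mul_pos (1 - p)).mono fun u hu => hasDerivAt_nextExpDeriv k hu)
    ((eventually_one_add_mul_pos (1 - q)).mono fun t ht => hasDerivAt_nextExp ht)
    (nextExp_zero q) n).self_of_nhds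
  rw [nextExpDeriv_zero_left] at h
  refine Eq.trans h ?_
  simp only [nextExp_zero, nextExpDeriv, sub_self, mul_zero, add_zero, one_pow, div_one, mul_one]
  exact Finset.sum_congr rfl fun k _ => by ring

lemma analyticAt_nextExp (q : ℝ) : AnalyticAt ℝ (nextExp q) 0 := by
  rcases eq_or_ne q 1 with rfl | hq
  · have : nextExp 1 = Real.exp := by funext u; simp [nextExp]
    rw [this]
    exact analyticAt_rexp
  · have hE : nextExp q = fun u => (1 + (1 - q) * u) ^ (1 / (1 - q)) := by
      funext u; simp [nextExp, hq]
    rw [hE]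
    have hlog : AnalyticAt ℝ (fun u : ℝ => Real.log (1 + (1 - q) * u)) 0 :=
      AnalyticAt.log (by fun_prop) (by simp)
    -- The real power agrees with `exp (log · * c)` where the base is positive, hence near `0`.
    refine (hlog.mul (analyticAt_const (v := 1 / (1 - q)))).rexp'.congr ?_
    filter_upwards [eventually_one_add_mul_pos (1 - q)] with u hu
    exact (Real.rpow_def_of_pos hu _).symm

lemma analyticAt_touchardGen (x p q : ℝ) : AnalyticAt ℝ (touchardGen x p q) 0 := by
  have hp := analyticAt_nextExp p
  have hq := analyticAt_nextExp q
  refine AnalyticAt.fun_comp (f := fun t => x * (nextExp q t - 1)) ?_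
    (analyticAt_const.mul (hq.sub analyticAt_const))
  simpa [nextExp_zero] using hp

lemma AnalyticAt.eventually_hasSum_iteratedDeriv {f : ℝ → ℝ} (hf : AnalyticAt ℝ f 0) :
    ∀ᶠ t in 𝓝 (0 : ℝ),
      HasSum (fun n : ℕ => iteratedDeriv n f 0 * (t ^ n / (Nat.factorial n : ℝ))) (f t) := by
  have h := hasFPowerSeriesAt_iff.1 hf.hasFPowerSeriesAt
  filter_upwards [h] with t ht
  simp only [zero_add] at ht
  simp only [FormalMultilinearSeries.coeff_ofScalars, smul_eq_mul] at ht
  simpa only [mul_div_left_comm] using ht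

-- Exchanging the sums over `m ≤ i < N` leaves the binomial expansion of `(1 - c)^i`.
open Finset in
lemma sum_Ico_choose_eq (N : ℕ) (c : ℝ) (h : ℕ → ℝ) :
    ∑ m ∈ range N, ∑ i ∈ Ico m N, (i.choose m : ℝ) * (-1) ^ m * c ^ m * h i =
      ∑ i ∈ range N, (1 - c) ^ i * h i := by
  simp only [range_eq_Ico]
  rw [sum_Ico_Ico_comm]
  refine sum_congr rfl fun i _ => ?_
  rw [← range_eq_Ico, ← sum_mul, sub_eq_neg_add, add_pow]
  congr 1
  refine sum_congr rfl fun m _ => ?_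
  rw [neg_pow]
  ring

/-- The missing term `i = k` carries `s(k, 0)`, which vanishes because `k ≠ 0`. -/
lemma sum_signedStirlingFirst_eq_prod {k : ℕ} (hk : k ≠ 0) (c : ℝ) :
    ∑ i ∈ Finset.range k, c ^ i * (signedStirlingFirst k (k - i) : ℝ) =
      ∏ j ∈ Finset.range k, (1 - j * c) := by
  rw [← stirlingFunctional_one, stirlingFunctional, ← Finset.sum_range_reflect
    (fun m => (signedStirlingFirst k m : ℝ) * c ^ (k - m) * 1), Finset.sum_range_succ]
  obtain ⟨k, rfl⟩ := Nat.exists_eq_succ_of_ne_zero hk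
  simp only [Nat.succ_eq_add_one, Nat.add_sub_cancel, Nat.sub_self, signedStirlingFirst_succ_zero,
    Int.cast_zero, zero_mul, add_zero, mul_one]
  refine Finset.sum_congr rfl fun i hi => ?_
  rw [Nat.sub_sub_self (Finset.mem_range.1 hi).le]
  ring

/-- Reversal `m = n - j`; terms with `j > n - k` drop out since `S(n - j, k) = 0`. -/
lemma sum_signedStirlingFirst_mul_stirlingSecond {n k : ℕ} (hk : k ≤ n) (b : ℝ) :
    ∑ j ∈ Finset.range (n - k + 1), b ^ j *
      ((signedStirlingFirst n (n - j) : ℝ) * (Nat.stirlingSecond (n - j) k : ℝ)) =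
      deformedStirling b n k := by
  rw [deformedStirling, stirlingFunctional, ← Finset.sum_range_reflect
    (fun m => (signedStirlingFirst n m : ℝ) * b ^ (n - m) * (Nat.stirlingSecond m k : ℝ))]
  have hsub : Finset.range (n - k + 1) ⊆ Finset.range (n + 1) :=
    Finset.range_subset_range.2 (by omega)
  rw [← Finset.sum_subset hsub]
  · refine Finset.sum_congr rfl fun j hj => ?_
    have := Finset.mem_range.1 hj
    rw [Nat.add_sub_cancel, Nat.sub_sub_self (by omega)]
    ring
  · intro j hj hj'
    simp only [Finset.mem_range] at hj hj'
    rw [Nat.add_sub_cancel, Nat.stirlingSecond_eq_zero_of_lt (show n - j < k by omega)]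
    simp

theorem theorem3p1 :
    (∀ x p q : ℝ, ∀ᶠ t in 𝓝 (0 : ℝ),
      HasSum (fun n : ℕ => deformedTouchard n x p q * (t ^ n / (Nat.factorial n : ℝ)))
        (nextExp p (x * (nextExp q t - 1)))) ∧
    ∀ n : ℕ, 1 ≤ n → ∀ x p q : ℝ,
      deformedTouchard n x p q =
        ∑ k ∈ Finset.range (n + 1), ∑ m ∈ Finset.range k, ∑ l ∈ Finset.range (n - k + 1),
          ∑ i ∈ Finset.Ico m k, ∑ j ∈ Finset.Icc l (n - k),
            (i.choose m : ℝ) * (j.choose l : ℝ) * (-1) ^ (m + l) *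
              (signedStirlingFirst n (n - j) : ℝ) * (Nat.stirlingSecond (n - j) k : ℝ) *
              (signedStirlingFirst k (k - i) : ℝ) * p ^ m * q ^ l * x ^ k := by
  refine ⟨fun x p q => (analyticAt_touchardGen x p q).eventually_hasSum_iteratedDeriv,
    fun n hn x p q => ?_⟩
  rw [deformedTouchard_eq_sum]
  refine Finset.sum_congr rfl fun k hk => ?_
  -- For `k = 0` the sum over `m` is empty, and the coefficient vanishes because `n ≥ 1`.
  rcases eq_or_ne k 0 with rfl | hk0
  · simp [deformedStirling_zero_right (1 - q) (Nat.one_le_iff_ne_zero.1 hn)]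
  rw [← sum_signedStirlingFirst_mul_stirlingSecond (Nat.lt_succ_iff.1 (Finset.mem_range.1 hk)),
    ← sum_signedStirlingFirst_eq_prod hk0, ← sum_Ico_choose_eq, ← sum_Ico_choose_eq, mul_comm
    (Finset.sum _ _) (Finset.sum _ _), Finset.sum_mul_sum, Finset.sum_mul]
  refine Finset.sum_congr rfl fun m _ => ?_
  rw [Finset.sum_mul]
  refine Finset.sum_congr rfl fun l _ => ?_
  rw [Finset.sum_mul_sum, Finset.sum_mul]
  refine Finset.sum_congr rfl fun i _ => ?_
  rw [Finset.sum_mul]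
  have : Finset.Ico l (n - k + 1) = Finset.Icc l (n - k) := by ext; simp
  rw [this]
  refine Finset.sum_congr rfl fun j _ => ?_
  ring
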